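/- Let $M$ be an oriented closed connected (topological) $n$-manifold with fundamental group $\Gamma$ and universal covering $\pi\colon\widetilde M\to M$, on which $\Gamma$ acts by deck transformations. A standard $\Gamma$-space $\alpha=\Gamma\curvearrowright(X,\mu)$ is a standard Borel probability space $(X,\mu)$ with a measurable $\mu$-preserving left $\Gamma$-action; it is free if the action is free on a subset of full measure, and non-atomic if $\mu$ has no atoms. Equip $L^\infty(X,\mu;\mathbb Z)$ with the right $\Gamma$-action $(f\cdot g)(x)=f(gx)$ and put $$C_*(M;\alpha)=L^\infty(X,\mu;\mathbb Z)\otimes_{\mathbb Z\Gamma}C_*(\widetilde M;\mathbb Z).$$ An $\alpha$-parametrized fundamental cycle of $M$ is a cycle in $C_n(M;\alpha)$ that represents the image of the integral fundamental class $[M]_{\mathbb Z}\in H_n(M;\mathbb Z)$ under the map induced by $C_*(M;\mathbb Z)\cong\mathbb Z\otimes_{\mathbb Z\Gamma}C_*(\widetilde M;\mathbb Z)\to C_*(M;\alpha)$, $1\otimes c\mapsto 1\otimes c$. The $\ell^1$-norm of a chain $c=\sum_{j=1}^k f_j\otimes\sigma_j$ in reduced form (i.e. the singular simplices $\pi\circ\sigma_1,\dots,\pi\circ\sigma_k$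 of $M$ are pairwise distinct) is $\sum_{j=1}^k\int_X|f_j|\,d\mu$, and the $\alpha$-parametrized simplicial volume $|M|^\alpha$ is the infimum of the $\ell^1$-norms of all $\alpha$-parametrized fundamental cycles of $M$. A standard $\Gamma$-space $\alpha=\Gamma\curvearrowright(X,\mu)$ is weakly contained in a standard $\Gamma$-space $\beta=\Gamma\curvearrowright(Y,\nu)$ if for all $\varepsilon>0$, all finite $F\subset\Gamma$, all $m\in\mathbb N$ and all Borel sets $A_1,\dots,A_m\subset X$ there are Borel sets $B_1,\dots,B_m\subset Y$ such that $|\mu(\gamma A_j\cap A_k)-\nu(\gamma B_j\cap B_k)|<\varepsilon$ for all $\gamma\in F$ and all $j,k\in\{1,\dots,m\}$. **Theorem.** Let $\alpha=\Gamma\curvearrowright(X,\mu)$ and $\beta=\Gamma\curvearrowright(Y,\nu)$ be free non-atomic standard $\Gamma$-spaces such that $\alpha$ is weakly contained in $\beta$. Then $$|M|^\beta\le|M|^\alpha.$$ -/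

import Mathlib

open MeasureTheory
open scoped ENNReal Pointwise TensorProduct

noncomputable section

namespace IFSV

/-! ### Singular chains -/

/-- The standard topological `n`-simplex. -/
abbrev Simplex (n : ℕ) : Type := stdSimplex ℝ (Fin (n + 1))

/-- Singular `n`-simplices of the space `T`. -/
abbrev SingularSimplex (n : ℕ) (T : Type*) [TopologicalSpace T] := C(Simplex n, T)

/-- The group `C_n(T; ℤ)` of integral singular `n`-chains: the free abelian group on the
singular `n`-simplices. -/
abbrev Chain (n : ℕ) (T : Type*) [TopologicalSpace T] := SingularSimplex n T →₀ ℤ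

section Chains

variable {n : ℕ} {S T U : Type*} [TopologicalSpace S] [TopologicalSpace T] [TopologicalSpace U]

/-- The inclusion of the `i`-th face `Δⁿ → Δⁿ⁺¹`, opposite to the vertex `eᵢ`. -/
def faceInclusion (n : ℕ) (i : Fin (n + 2)) : C(Simplex n, Simplex (n + 1)) :=
  ⟨stdSimplex.map i.succAbove, stdSimplex.continuous_map _⟩

/-- The singular boundary `∂σ = ∑ᵢ (-1)ⁱ (σ ∘ ιᵢ)`, as a map `C_{n+1}(T) → C_n(T)`. -/
def boundary (n : ℕ) (T : Type*) [TopologicalSpace T] : Chain (n + 1) T →ₗ[ℤ] Chain n T :=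
  Finsupp.linearCombination ℤ fun σ : SingularSimplex (n + 1) T =>
    ∑ i : Fin (n + 2), Finsupp.single (σ.comp (faceInclusion n i)) ((-1 : ℤ) ^ (i : ℕ))

/-- The map induced on singular chains by a continuous map. -/
def chainMap (n : ℕ) (f : C(S, T)) : Chain n S →ₗ[ℤ] Chain n T :=
  Finsupp.lmapDomain ℤ ℤ fun σ : SingularSimplex n S => f.comp σ

theorem boundary_single (σ : SingularSimplex (n + 1) T) (a : ℤ) :
    boundary n T (Finsupp.single σ a) =
      a • ∑ i : Fin (n + 2), Finsupp.single (σ.comp (faceInclusion n i)) ((-1 : ℤ) ^ (i : ℕ)) := by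
  simp [boundary]

theorem chainMap_single (f : C(S, T)) (σ : SingularSimplex n S) (a : ℤ) :
    chainMap n f (Finsupp.single σ a) = Finsupp.single (f.comp σ) a := by
  simp [chainMap, Finsupp.mapDomain_single]

theorem boundary_chainMap (f : C(S, T)) (c : Chain (n + 1) S) :
    boundary n T (chainMap (n + 1) f c) = chainMap n f (boundary n S c) := by
  induction c using Finsupp.induction_linear with
  | zero => simp
  | add a b ha hb => simp only [map_add, ha, hb]
  | single σ a =>
    simp [boundary, chainMap, Finsupp.mapDomain_single, ContinuousMap.comp_assoc]

/-! ### Singular homology of pairs -/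

/-- The subgroup `C_n(A) ⊆ C_n(T)` of chains supported in the subset `A ⊆ T`. -/
def chainsIn (n : ℕ) (A : Set T) : Submodule ℤ (Chain n T) :=
  Finsupp.supported ℤ ℤ {σ : SingularSimplex n T | Set.range σ ⊆ A}

theorem chainsIn_mono {A B : Set T} (h : A ⊆ B) : chainsIn n A ≤ chainsIn n B :=
  Finsupp.supported_mono fun _ hσ => hσ.trans h

/-- The cycles of the pair `(T, A)`: chains whose boundary is supported in `A`
(all chains in degree `0`). -/
def relCycles : (n : ℕ) → (A : Set T) → Submodule ℤ (Chain n T)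
  | 0, _ => ⊤
  | n + 1, A => (chainsIn n A).comap (boundary n T)

/-- The boundaries of the pair `(T, A)`: sums of a boundary and a chain supported in `A`. -/
def relBoundaries (n : ℕ) (A : Set T) : Submodule ℤ (Chain n T) :=
  LinearMap.range (boundary n T) ⊔ chainsIn n A

theorem relCycles_mono {A B : Set T} (h : A ⊆ B) : relCycles n A ≤ relCycles n B := by
  cases n with
  | zero => exact le_rfl
  | succ n => exact Submodule.comap_mono (chainsIn_mono h)

theorem relBoundaries_mono {A B : Set T} (h : A ⊆ B) :
    relBoundaries n A ≤ relBoundaries n B :=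
  sup_le_sup_left (chainsIn_mono h) _

/-- The singular homology group `H_n(T, A; ℤ)`; for `A = ∅` this is `H_n(T; ℤ)`. -/
abbrev RelHomology (n : ℕ) (A : Set T) :=
  relCycles n A ⧸ (relBoundaries n A).submoduleOf (relCycles n A)

/-- The class in `H_n(T, A; ℤ)` of a cycle of the pair `(T, A)`. -/
def homologyClass {A : Set T} (z : relCycles n A) : RelHomology n A :=
  Submodule.Quotient.mk z

/-- The map `H_n(T, A; ℤ) → H_n(T, B; ℤ)` induced by the identity of `T`, for `A ⊆ B`. -/
def restrict {A B : Set T} (h : A ⊆ B) : RelHomology n A →ₗ[ℤ] RelHomology n B :=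
  Submodule.mapQ _ _ (Submodule.inclusion (relCycles_mono h)) fun _ hz =>
    relBoundaries_mono h hz

end Chains

/-! ### Orientations and fundamental cycles -/

/-- A (homological) orientation of the `n`-manifold `M`: a choice of generators
`o_x ∈ H_n(M, M ∖ {x}; ℤ)` which is locally induced by a class in `H_n(M, M ∖ U; ℤ)`. -/
structure Orientation (n : ℕ) (M : Type*) [TopologicalSpace M] where
  localClass : ∀ x : M, RelHomology n ({x}ᶜ : Set M)
  generates : ∀ x : M, Submodule.span ℤ {localClass x} = ⊤
  locally_consistent : ∀ x : M, ∃ U : Set M, IsOpen U ∧ x ∈ U ∧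
    ∃ ω : RelHomology n Uᶜ, ∀ (y : M) (hy : y ∈ U),
      restrict (Set.compl_subset_compl.mpr (Set.singleton_subset_iff.mpr hy)) ω = localClass y

/-- `z` is an integral fundamental cycle of the closed oriented `n`-manifold `M`: a singular
cycle whose class restricts to the given local orientation at every point, i.e. a cycle
representing the fundamental class `[M]_ℤ`. -/
def IsFundamentalCycle {n : ℕ} {M : Type*} [TopologicalSpace M] (o : Orientation n M)
    (z : Chain n M) : Prop :=
  ∃ hz : z ∈ relCycles n (∅ : Set M), ∀ x : M,
    restrict (Set.empty_subset _) (homologyClass ⟨z, hz⟩) = o.localClass x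

/-! ### The universal covering and the fundamental group -/

/-- `p : E → M` is a universal covering of `M`, on whose total space the group `Γ` acts as the
group of deck transformations. By `IsUniversalCovering.nonempty_fundamentalGroup_mulEquiv`,
`Γ` is then the fundamental group of `M`. -/
structure IsUniversalCovering (Γ : Type*) [Group Γ] {E M : Type*} [TopologicalSpace E]
    [TopologicalSpace M] [MulAction Γ E] (p : E → M) : Prop where
  simplyConnected : SimplyConnectedSpace E
  covering : IsCoveringMap p
  deck : IsQuotientCoveringMap p Γ

theorem IsUniversalCovering.nonempty_fundamentalGroup_mulEquiv {Γ : Type*} [Group Γ]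
    {E M : Type*} [TopologicalSpace E] [TopologicalSpace M] [MulAction Γ E] {p : E → M}
    (hp : IsUniversalCovering Γ p) (x : M) : Nonempty (FundamentalGroup M x ≃* Γ) := by
  have := hp.simplyConnected
  obtain ⟨e, he⟩ := hp.deck.surjective x
  exact ⟨(hp.deck.fundamentalGroupEquiv (⟨e, he⟩ : p ⁻¹' {x})).trans (MulEquiv.inv' Γ).symm⟩

/-! ### Chains with twisted coefficients -/

section Twisted

variable (Γ : Type*) [Group Γ] (A : Type*) [AddCommGroup A] [DistribMulAction Γᵈᵐᵃ A]
  (n : ℕ) (E : Type*) [TopologicalSpace E] [MulAction Γ E] [ContinuousConstSMul Γ E]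

/-- The action of `g ∈ Γ` on the singular chains of the `Γ`-space `E`. -/
def translate {Γ : Type*} [Group Γ] (n : ℕ) {E : Type*} [TopologicalSpace E] [MulAction Γ E]
    [ContinuousConstSMul Γ E] (g : Γ) : Chain n E →ₗ[ℤ] Chain n E :=
  chainMap n ⟨fun y => g • y, continuous_const_smul g⟩

/-- The relations `f · g ⊗ c = f ⊗ g · c` of the tensor product over `ℤΓ`. A right `Γ`-module is
encoded as a module over `Γᵈᵐᵃ` (the opposite of `Γ`); so `DomMulAct.mk g • f` is `f · g`. -/
def balancing : AddSubgroup (A ⊗[ℤ] Chain n E) :=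
  AddSubgroup.closure {t | ∃ (g : Γ) (f : A) (c : Chain n E),
    t = (DomMulAct.mk g • f) ⊗ₜ[ℤ] c - f ⊗ₜ[ℤ] translate n g c}

/-- `A ⊗_{ℤΓ} C_n(E; ℤ)`, for a right `Γ`-module `A` and a left `Γ`-space `E`. -/
abbrev TwistedChain := (A ⊗[ℤ] Chain n E) ⧸ balancing Γ A n E

variable {A n E}

/-- The element `f ⊗ c` of `A ⊗_{ℤΓ} C_n(E; ℤ)`. -/
def tmul (f : A) (c : Chain n E) : TwistedChain Γ A n E :=
  QuotientAddGroup.mk (f ⊗ₜ[ℤ] c)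

theorem tmul_smul_left (g : Γ) (f : A) (c : Chain n E) :
    tmul Γ (DomMulAct.mk g • f) c = tmul Γ f (translate n g c) :=
  QuotientAddGroup.eq_iff_sub_mem.mpr (AddSubgroup.subset_closure ⟨g, f, c, rfl⟩)

variable (A n E)

theorem balancing_le_comap : balancing Γ A (n + 1) E ≤
    (balancing Γ A n E).comap (LinearMap.lTensor A (boundary n E)).toAddMonoidHom := by
  rw [balancing, AddSubgroup.closure_le]
  rintro _ ⟨g, f, c, rfl⟩
  refine AddSubgroup.subset_closure ⟨g, f, boundary n E c, ?_⟩
  rw [map_sub]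
  simp [translate, boundary_chainMap]

/-- The boundary operator `id ⊗ ∂` of `A ⊗_{ℤΓ} C_*(E; ℤ)`. -/
def twistedBoundary : TwistedChain Γ A (n + 1) E →+ TwistedChain Γ A n E :=
  QuotientAddGroup.map _ _ (LinearMap.lTensor A (boundary n E)).toAddMonoidHom
    (balancing_le_comap Γ A n E)

theorem twistedBoundary_tmul (f : A) (c : Chain (n + 1) E) :
    twistedBoundary Γ A n E (tmul Γ f c) = tmul Γ f (boundary n E c) := rfl

/-- The `n`-cycles of `A ⊗_{ℤΓ} C_*(E; ℤ)` (all chains in degree `0`). -/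
def twistedCycles : (n : ℕ) → AddSubgroup (TwistedChain Γ A n E)
  | 0 => ⊤
  | n + 1 => (twistedBoundary Γ A n E).ker

end Twisted

/-! ### Parametrized fundamental cycles and parametrized simplicial volume -/

/-- The group `L^∞(X, μ; ℤ)` of (classes of) essentially bounded measurable functions `X → ℤ`.
If `Γ` acts on `(X, μ)`, then Mathlib's action of `Γᵈᵐᵃ` on it is the right action
`(f · g)(x) = f (g • x)`. -/
abbrev LinfInt {X : Type*} [MeasurableSpace X] (μ : Measure X) := Lp ℤ ∞ μ

section Parametrized

variable (Γ : Type*) [Group Γ] {n : ℕ} {E M : Type*} [TopologicalSpace E] [TopologicalSpace M]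
  [MulAction Γ E] [ContinuousConstSMul Γ E] (p : C(E, M))
  {X : Type*} [MeasurableSpace X] [MulAction Γ X] [MeasurableConstSMul Γ X]
  (μ : Measure X) [IsProbabilityMeasure μ] [SMulInvariantMeasure Γ X μ]

/-- `C_n(M; α) = L^∞(X, μ; ℤ) ⊗_{ℤΓ} C_n(E; ℤ)`, for the standard `Γ`-space `α = Γ ↷ (X, μ)` and
the universal covering space `E` of `M`. -/
abbrev ParamChain (n : ℕ) (E : Type*) [TopologicalSpace E] [MulAction Γ E]
    [ContinuousConstSMul Γ E] :=
  TwistedChain Γ (LinfInt μ) n E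

/-- `c` is the image of the integral chain `z` under the change of coefficients map
`C_n(M; ℤ) ≅ ℤ ⊗_{ℤΓ} C_n(E; ℤ) → C_n(M; α)`, `1 ⊗ w ↦ 1 ⊗ w`, where the isomorphism is given by
`p_* w ↤ 1 ⊗ w` and where `1 ∈ L^∞(X, μ; ℤ)` is the constant function. -/
def IsCoefficientImage (z : Chain n M) (c : ParamChain Γ μ n E) : Prop :=
  ∃ w : Chain n E, chainMap n p w = z ∧ c = tmul Γ (Lp.const ∞ μ (1 : ℤ)) w

/-- `c` is an `α`-parametrized fundamental cycle of `M`: a cycle in `C_n(M; α)` that is homologous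
to the image of an integral fundamental cycle of `M`. -/
def IsParamFundamentalCycle (o : Orientation n M) (c : ParamChain Γ μ n E) : Prop :=
  c ∈ twistedCycles Γ (LinfInt μ) E n ∧
    ∃ (z : Chain n M) (c' : ParamChain Γ μ n E),
      IsFundamentalCycle o z ∧ IsCoefficientImage Γ p μ z c' ∧
      c - c' ∈ (twistedBoundary Γ (LinfInt μ) n E).range

/-- `∑ⱼ fⱼ ⊗ σⱼ` is a reduced form of `c`: it represents `c`, and the projections to `M` of the
singular simplices `σⱼ` are pairwise distinct. -/
def IsReducedForm (c : ParamChain Γ μ n E) {k : ℕ} (f : Fin k → LinfInt μ)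
    (σ : Fin k → SingularSimplex n E) : Prop :=
  Function.Injective (fun j => p.comp (σ j)) ∧
    c = ∑ j, tmul Γ (f j) (Finsupp.single (σ j) 1)

/-- The `ℓ¹`-norm `∑ⱼ ∫ |fⱼ| dμ` of a parametrized chain, computed from a reduced form
`∑ⱼ fⱼ ⊗ σⱼ`. (Every chain has reduced forms, and they all give the same finite value; so the
infimum over all reduced forms is this common value.) -/
def l1Norm (c : ParamChain Γ μ n E) : ℝ≥0∞ :=
  ⨅ (k : ℕ) (f : Fin k → LinfInt μ) (σ : Fin k → SingularSimplex n E)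
    (_ : IsReducedForm Γ p μ c f σ), ∑ j, ∫⁻ x, ‖f j x‖ₑ ∂μ

/-- The `α`-parametrized simplicial volume of `M`: the infimum of the `ℓ¹`-norms of all
`α`-parametrized fundamental cycles of `M`. -/
def paramSimplicialVolume (o : Orientation n M) : ℝ≥0∞ :=
  ⨅ (c : ParamChain Γ μ n E) (_ : IsParamFundamentalCycle Γ p μ o c), l1Norm Γ p μ c

end Parametrized

/-! ### Free actions and weak containment -/

/-- The action of `Γ` on `(X, μ)` is essentially free. -/
def EssentiallyFree (Γ : Type*) [Group Γ] {X : Type*} [MeasurableSpace X] [MulAction Γ X]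
    (μ : Measure X) : Prop :=
  ∀ᵐ x ∂μ, ∀ g : Γ, g • x = x → g = 1

/-- `Γ ↷ (X, μ)` is weakly contained in `Γ ↷ (Y, ν)`. -/
def WeaklyContained (Γ : Type*) [Group Γ] {X Y : Type*} [MeasurableSpace X] [MeasurableSpace Y]
    [MulAction Γ X] [MulAction Γ Y] (μ : Measure X) (ν : Measure Y) : Prop :=
  ∀ ε : ℝ, 0 < ε → ∀ (F : Finset Γ) (m : ℕ) (A : Fin m → Set X), (∀ j, MeasurableSet (A j)) →
    ∃ B : Fin m → Set Y, (∀ j, MeasurableSet (B j)) ∧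
      ∀ g ∈ F, ∀ j k, |μ.real (g • A j ∩ A k) - ν.real (g • B j ∩ B k)| < ε

end IFSV

end

/-! A parametrized fundamental cycle over α is `1 ⊗ w + ∑ ∂(fⱼ ⊗ σⱼ)`, where `w` lifts an integral
fundamental cycle. Replacing the `fⱼ` by any functions on `Y`, while keeping `1`, `w` and the `σⱼ`,
yields a parametrized fundamental cycle over β. So it suffices to choose the new functions such that
the norm grows by at most `ε`. Choosing one simplex in each `Γ`-orbit turns the norm into a finite
sum of `L¹`-norms of coordinates, and each coordinate is a ℤ-linear combination of translates of the
coefficient functions, with a shape that depends only on the simplices (`coord_sum_tmul_apply`).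
Such an `L¹`-norm is determined by the joint distribution of finitely many translates of finitely
many functions with finitely many values. Weak containment reproduces these distributions on `Y` up
to a small error (`WeaklyContained.exists_coding`, `WeaklyContained.exists_transfer`). -/

noncomputable section

namespace IFSV

/-! ### Weak containment as transport of finite codings -/

section WeakContainment

variable {Γ : Type*} [Group Γ]
  {X : Type*} [MeasurableSpace X] [MulAction Γ X] {μ : Measure X} [IsProbabilityMeasure μ]
  {Y : Type*} [MeasurableSpace Y] [MulAction Γ Y]
  {ν : Measure Y} [IsProbabilityMeasure ν] [SMulInvariantMeasure Γ Y ν]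

/-- Almost disjoint sets whose measures almost add up to `1` almost cover the space. -/
theorem measureReal_compl_iUnion_le {ι : Type*} [Fintype ι] {B : ι → Set Y}
    (hB : ∀ i, MeasurableSet (B i)) {a : ι → ℝ} (ha : ∑ i, a i = 1) {δ : ℝ} (hδ : 0 ≤ δ)
    (hle : ∀ i, a i - δ ≤ ν.real (B i)) (hdisj : ∀ i j, i ≠ j → ν.real (B i ∩ B j) ≤ δ) :
    ν.real (⋃ i, B i)ᶜ ≤
      Fintype.card ι * (1 + Fintype.card ι * Fintype.card ι) * δ := by
  classical
  set N : ℝ := (Fintype.card ι : ℝ)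
  -- Off the overlap set `D`, of mass at most `N²δ`, the sets are disjoint and their masses add up.
  -- Each of the `N` sets loses at most `δ + N²δ`.
  set D : Set Y := ⋃ ij : ι × ι, if ij.1 = ij.2 then ∅ else B ij.1 ∩ B ij.2 with hD
  have hDm : MeasurableSet D := by
    refine MeasurableSet.iUnion fun ij => ?_
    split_ifs
    · exact MeasurableSet.empty
    · exact (hB _).inter (hB _)
  have hDle : ν.real D ≤ N * N * δ := by
    refine (measureReal_iUnion_fintype_le _).trans ?_
    refine (Finset.sum_le_sum (g := fun _ => δ) fun ij _ => ?_).trans_eq ?_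
    · split_ifs with h
      · simpa using hδ
      · exact hdisj _ _ h
    · simp [N, Fintype.card_prod]
  have hpd : Pairwise (Function.onFun Disjoint fun i => B i \ D) := by
    intro i j hij
    refine Set.disjoint_left.mpr fun y hi hj => hi.2 ?_
    refine Set.mem_iUnion.mpr ⟨(i, j), ?_⟩
    simpa [hij] using ⟨hi.1, hj.1⟩
  have hsum : ν.real (⋃ i, B i \ D) = ∑ i, ν.real (B i \ D) :=
    measureReal_iUnion_fintype hpd fun i => (hB i).diff hDm
  have hge : ∀ i, a i - δ - N * N * δ ≤ ν.real (B i \ D) := fun i => by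
    have := le_measureReal_sdiff (μ := ν) (s₁ := B i) (s₂ := D)
    linarith [hle i]
  have htot : 1 - N * (1 + N * N) * δ ≤ ν.real (⋃ i, B i) := by
    have h1 : ∑ i, (a i - δ - N * N * δ) ≤ ν.real (⋃ i, B i) := by
      refine (Finset.sum_le_sum fun i _ => hge i).trans (hsum.symm.le.trans ?_)
      exact measureReal_mono (Set.iUnion_mono fun i => Set.sdiff_subset)
    simp only [Finset.sum_sub_distrib, ha, Finset.sum_const, Finset.card_univ, nsmul_eq_mul] at h1
    change 1 - N * δ - N * (N * N * δ) ≤ _ at h1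
    linarith
  rw [probReal_compl_eq_one_sub (MeasurableSet.iUnion hB)]
  linarith

/-- Weak containment allows to transport finite codings, up to a small error on the joint
distribution with finitely many translates. -/
theorem WeaklyContained.exists_coding (h : WeaklyContained Γ μ ν) {Q : Type*} [Finite Q]
    [MeasurableSpace Q] [MeasurableSingletonClass Q] {φ : X → Q} (hφ : Measurable φ)
    (F : Finset Γ) {ε : ℝ≥0∞} (hε : ε ≠ 0) :
    ∃ ψ : Y → Q, Measurable ψ ∧ ∀ g ∈ F, ∀ q r,
      ν {y | ψ (g • y) = q ∧ ψ y = r} ≤ μ {x | φ (g • x) = q ∧ φ x = r} + ε := by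
  classical
  have : Fintype Q := Fintype.ofFinite Q
  obtain ⟨x₀⟩ : Nonempty X := nonempty_of_isProbabilityMeasure μ
  obtain ⟨m, ⟨e⟩⟩ := Finite.exists_equiv_fin Q
  set N : ℝ := (Fintype.card Q : ℝ)
  -- The final error is one `δ` from weak containment plus twice the mass of the uncovered set: once
  -- at `y` and once at `g • y`.
  set K : ℝ := 1 + 2 * (N * (1 + N * N)) with hK
  have hKpos : 0 < K := by positivity
  -- The truncation at `1` turns a possibly infinite `ε` into a positive real number.
  set ε' : ℝ := (min ε 1).toReal
  have hε' : 0 < ε' := ENNReal.toReal_pos (by simp [hε]) (by simp)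
  set δ : ℝ := ε' / K
  have hδ : 0 < δ := by positivity
  -- Inverses appear because `φ (g • x) = q` means `x ∈ g⁻¹ • φ ⁻¹' {q}`; the element `1` controls
  -- the masses and overlaps of the `B i`.
  obtain ⟨B, hB, hAB⟩ := h δ hδ (insert 1 (F.image (·⁻¹))) m (fun i => φ ⁻¹' {e.symm i})
    fun i => hφ (measurableSet_singleton _)
  set C : Q → Set Y := fun q => B (e q)
  have hC : ∀ q, MeasurableSet (C q) := fun q => hB _
  have hAC : ∀ g ∈ insert 1 (F.image (·⁻¹)), ∀ q r,
      |μ.real (g • φ ⁻¹' {q} ∩ φ ⁻¹' {r}) - ν.real (g • C q ∩ C r)| < δ := by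
    intro g hg q r
    simpa [C] using hAB g hg (e q) (e r)
  have hone : ∀ q r, |μ.real (φ ⁻¹' {q} ∩ φ ⁻¹' {r}) - ν.real (C q ∩ C r)| < δ := by
    intro q r
    simpa using hAC 1 (by simp) q r
  have hDle : ν.real (⋃ q, C q)ᶜ ≤ N * (1 + N * N) * δ := by
    refine measureReal_compl_iUnion_le (a := fun q => μ.real (φ ⁻¹' {q})) hC ?_ hδ.le ?_ ?_
    · rw [sum_measureReal_preimage_singleton _ fun q _ => hφ (measurableSet_singleton q)]
      simp
    · intro q
      have := abs_lt.mp (hone q q)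
      simp only [Set.inter_self] at this
      linarith
    · intro q r hqr
      have := abs_lt.mp (hone q r)
      have h0 : φ ⁻¹' {q} ∩ φ ⁻¹' {r} = ∅ := by
        ext x
        simp only [Set.mem_inter_iff, Set.mem_preimage, Set.mem_singleton_iff,
          Set.mem_empty_iff_false, iff_false, not_and]
        rintro rfl
        exact hqr
      rw [h0] at this
      simp only [measureReal_empty] at this
      linarith
  set D : Set Y := (⋃ q, C q)ᶜ with hD
  have hDm : MeasurableSet D := (MeasurableSet.iUnion hC).compl
  -- The sets `C q` only nearly partition `Y`: a point in several of them gets one of their labels,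
  -- a point in none gets the default label `φ x₀`.
  set c : Set Q → Q := fun s => if hs : s.Nonempty then hs.some else φ x₀
  have hc : ∀ s : Set Q, s.Nonempty → c s ∈ s := fun s hs => by
    simp only [c, hs, dif_pos]
    exact hs.some_mem
  set ψ : Y → Q := fun y => c {q | y ∈ C q}
  have hψ : Measurable ψ := by
    have h1 : Measurable fun y : Y => {q | y ∈ C q} :=
      measurable_set_iff.mpr fun q => (hC q).mem
    exact (measurable_of_finite c).comp h1
  have hψC : ∀ y, y ∉ D → y ∈ C (ψ y) := by
    intro y hy
    simp only [hD, Set.mem_compl_iff, not_not, Set.mem_iUnion] at hy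
    exact hc {q | y ∈ C q} hy
  refine ⟨ψ, hψ, fun g hg q r => ?_⟩
  have hsub : {y | ψ (g • y) = q ∧ ψ y = r} ⊆
      (g⁻¹ • C q ∩ C r) ∪ ((fun y => g • y) ⁻¹' D ∪ D) := by
    rintro y ⟨rfl, rfl⟩
    by_cases h1 : y ∈ D
    · exact Or.inr (Or.inr h1)
    by_cases h2 : g • y ∈ D
    · exact Or.inr (Or.inl h2)
    · refine Or.inl ⟨?_, hψC y h1⟩
      rw [Set.mem_inv_smul_set_iff]
      exact hψC _ h2
  have hpre : ν.real ((fun y => g • y) ⁻¹' D) = ν.real D := by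
    simp only [measureReal_def, SMulInvariantMeasure.measure_preimage_smul g hDm]
  have hset : g⁻¹ • φ ⁻¹' {q} ∩ φ ⁻¹' {r} = {x | φ (g • x) = q ∧ φ x = r} := by
    ext x
    simp [Set.mem_inv_smul_set_iff]
  have hreal : ν.real {y | ψ (g • y) = q ∧ ψ y = r} ≤
      μ.real {x | φ (g • x) = q ∧ φ x = r} + ε' := by
    have h1 := measureReal_mono (μ := ν) hsub
    have h2 := measureReal_union_le (μ := ν) (g⁻¹ • C q ∩ C r) ((fun y => g • y) ⁻¹' D ∪ D)
    have h3 := measureReal_union_le (μ := ν) ((fun y => g • y) ⁻¹' D) D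
    have h4 := abs_lt.mp (hAC g⁻¹
      (Finset.mem_insert_of_mem (Finset.mem_image_of_mem _ hg)) q r)
    rw [hset] at h4
    have h5 : ε' = K * δ := by simp only [δ]; field_simp
    rw [hpre] at h3
    rw [h5, hK]
    linarith
  calc ν {y | ψ (g • y) = q ∧ ψ y = r}
      = ENNReal.ofReal (ν.real {y | ψ (g • y) = q ∧ ψ y = r}) := by simp
    _ ≤ ENNReal.ofReal (μ.real {x | φ (g • x) = q ∧ φ x = r} + ε') := ENNReal.ofReal_le_ofReal hreal
    _ = μ {x | φ (g • x) = q ∧ φ x = r} + min ε 1 := by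
      rw [ENNReal.ofReal_add measureReal_nonneg hε'.le, ofReal_measureReal,
        ENNReal.ofReal_toReal (by simp)]
    _ ≤ _ := by gcongr; exact min_le_left _ _

variable [MeasurableConstSMul Γ X] [MeasurableConstSMul Γ Y]

/-- Weak containment allows to transport finite families of bounded integer-valued functions, such
that the `L¹`-norms of finitely many given linear combinations of translates hardly increase. -/
theorem WeaklyContained.exists_coding_lintegral_le (h : WeaklyContained Γ μ ν)
    {J : Type*} [Fintype J]
    {f : J → X → ℤ} (hf : ∀ j, Measurable (f j)) {K : ℕ} (hK : ∀ j x, (f j x).natAbs ≤ K)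
    (N : Finset (J × Γ →₀ ℤ)) {ε : ℝ≥0∞} (hε : ε ≠ 0) :
    ∃ t : Y → X, (∀ j, Measurable fun y => f j (t y)) ∧ ∀ n ∈ N,
      ∫⁻ y, ‖n.sum fun i a => a * f i.1 (t (i.2 • y))‖ₑ ∂ν ≤
        ∫⁻ x, ‖n.sum fun i a => a * f i.1 (i.2 • x)‖ₑ ∂μ + ε := by
  classical
  set F : Finset Γ := insert 1 (N.biUnion fun n => n.support.image Prod.snd) with hF
  -- The code of `x` records all values `f j (g • x)` with `g ∈ F`. Boundedness leaves only finitely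
  -- many codes, and the given linear combinations factor through them.
  set φ₀ : X → (J × F → ℤ) := fun x i => f i.1 ((i.2 : Γ) • x) with hφ₀
  have hφ₀m : Measurable φ₀ :=
    measurable_pi_lambda _ fun i => (hf i.1).comp (measurable_const_smul (i.2 : Γ))
  have hfin : (Set.range φ₀).Finite := by
    refine (Set.Finite.pi' fun _ : J × F => Set.finite_Icc (-(K : ℤ)) K).subset ?_
    rintro _ ⟨x, rfl⟩ i
    have := hK i.1 ((i.2 : Γ) • x)
    simp only [hφ₀, Set.mem_Icc]
    omega
  have : Finite (Set.range φ₀) := hfin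
  have : Fintype (Set.range φ₀) := Fintype.ofFinite _
  set φ : X → Set.range φ₀ := Set.rangeFactorization φ₀
  have hφm : Measurable φ := hφ₀m.subtype_mk
  have hφ : ∀ x x', φ x = φ x' → ∀ j, ∀ g ∈ F, f j (g • x) = f j (g • x') := by
    intro x x' hxx j g hg
    exact congr_fun (congr_arg Subtype.val hxx) (j, ⟨g, hg⟩)
  -- The section `s` picks a point for each code; the map `t` will be `s ∘ ψ`.
  obtain ⟨s, hs⟩ := (Set.rangeFactorization_surjective (f := φ₀)).hasRightInverse
  have hs' : ∀ q, φ (s q) = q := hs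
  have h1F : (1 : Γ) ∈ F := by simp [hF]
  have hφ1 : ∀ x x', φ x = φ x' → ∀ j, f j x = f j x' := fun x x' hxx j => by
    simpa using hφ x x' hxx j 1 h1F
  -- a common bound for the linear combinations
  set C : ℕ := ∑ n ∈ N, n.sum fun _ a => a.natAbs * K
  have hC : ∀ n ∈ N, ∀ u : J × Γ → X,
      ‖n.sum fun i a => a * f i.1 (u i)‖ₑ ≤ (C : ℝ≥0∞) := by
    intro n hn u
    have h1 : (n.sum fun i a => a * f i.1 (u i)).natAbs ≤ C := by
      refine le_trans ?_ (Finset.single_le_sum (f := fun n : J × Γ →₀ ℤ =>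
        n.sum fun _ a => a.natAbs * K) (fun _ _ => Nat.zero_le _) hn)
      refine (Int.natAbs_sum_le _ _).trans (Finset.sum_le_sum fun i _ => ?_)
      rw [Int.natAbs_mul]
      exact Nat.mul_le_mul_left _ (hK _ _)
    have h2 : ‖n.sum fun i a => a * f i.1 (u i)‖ₑ
        = ((n.sum fun i a => a * f i.1 (u i)).natAbs : ℝ≥0∞) := by
      rw [enorm_eq_nnnorm, ← NNReal.natCast_natAbs]
      simp
    rw [h2]
    exact_mod_cast h1
  set k : ℝ≥0∞ := (Fintype.card (Set.range φ₀) : ℝ≥0∞)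
  -- Total weight of the errors: `k` code fibres, and `|F| k²` possible pairs of codes in the bad
  -- set, each weighted by the bound `C`. If `T = 0`, then `δ = ∞`, which is harmless.
  set T : ℝ≥0∞ := C * k + C * (F.card * (k * k)) with hT
  have hTtop : T ≠ ∞ := by
    simp only [hT, k]
    exact_mod_cast ENNReal.natCast_ne_top
      (C * Fintype.card (Set.range φ₀) + C * (F.card * (Fintype.card (Set.range φ₀) *
        Fintype.card (Set.range φ₀))))
  set δ : ℝ≥0∞ := ε / T
  have hδ : δ ≠ 0 := (ENNReal.div_pos hε hTtop).ne'
  obtain ⟨ψ, hψ, hle⟩ := h.exists_coding hφm F hδ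
  refine ⟨fun y => s (ψ y), fun j => (measurable_of_finite fun q => f j (s q)).comp hψ,
    fun n hn => ?_⟩
  set L : X → ℤ := fun x => n.sum fun i a => a * f i.1 (i.2 • x)
  -- The pairs of codes at `g • y` and `y` that never occur in `X`. They have mass `0` in `X`, hence
  -- mass at most `δ` in `Y`.
  set Bad : Set Y := ⋃ i : F × (Set.range φ₀ × Set.range φ₀),
    if ∃ x, φ ((i.1 : Γ) • x) = i.2.1 ∧ φ x = i.2.2 then ∅
    else {y | ψ ((i.1 : Γ) • y) = i.2.1 ∧ ψ y = i.2.2} with hBad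
  have hBadm : MeasurableSet Bad := by
    refine MeasurableSet.iUnion fun i => ?_
    split_ifs
    · exact MeasurableSet.empty
    · exact ((hψ.comp (measurable_const_smul (i.1 : Γ))) (measurableSet_singleton i.2.1)).inter
        (hψ (measurableSet_singleton i.2.2))
  have hBadle : ν Bad ≤ F.card * (k * k) * δ := by
    refine (measure_iUnion_fintype_le ν _).trans ?_
    refine (Finset.sum_le_sum (g := fun _ => δ) fun i _ => ?_).trans_eq ?_
    · split_ifs with hx
      · simp
      · refine (hle i.1 i.1.2 _ _).trans_eq ?_
        have : {x | φ ((i.1 : Γ) • x) = i.2.1 ∧ φ x = i.2.2} = ∅ := by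
          ext x
          simpa using fun h1 h2 => hx ⟨x, h1, h2⟩
        simp [this]
    · simp [k, Fintype.card_prod]
  -- Off `Bad`, the code at `g • y` is consistent with the translate values recorded by the code at
  -- `y`, so translating in `Y` can be replaced by translating `s (ψ y)` in `X`.
  have hgood : ∀ y, y ∉ Bad → (n.sum fun i a => a * f i.1 (s (ψ (i.2 • y)))) = L (s (ψ y)) := by
    intro y hy
    refine Finset.sum_congr rfl fun i hi => ?_
    have hiF : i.2 ∈ F := Finset.mem_insert_of_mem
      (Finset.mem_biUnion.mpr ⟨n, hn, Finset.mem_image_of_mem _ hi⟩)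
    have hx : ∃ x, φ (i.2 • x) = ψ (i.2 • y) ∧ φ x = ψ y := by
      by_contra hx
      refine hy (Set.mem_iUnion.mpr ⟨(⟨i.2, hiF⟩, ψ (i.2 • y), ψ y), ?_⟩)
      rw [if_neg hx]
      exact ⟨rfl, rfl⟩
    obtain ⟨x, hx1, hx2⟩ := hx
    dsimp only
    rw [hφ1 (s (ψ (i.2 • y))) (i.2 • x) (by rw [hs', hx1]) i.1,
      hφ x (s (ψ y)) (by rw [hs', hx2]) i.1 i.2 hiF]
  have hLs : ∀ x, L (s (φ x)) = L x := by
    intro x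
    refine Finset.sum_congr rfl fun i hi => ?_
    have hiF : i.2 ∈ F := Finset.mem_insert_of_mem
      (Finset.mem_biUnion.mpr ⟨n, hn, Finset.mem_image_of_mem _ hi⟩)
    dsimp only
    rw [hφ (s (φ x)) x (hs' _) i.1 i.2 hiF]
  have hfib : ∀ q, ν (ψ ⁻¹' {q}) ≤ μ (φ ⁻¹' {q}) + δ := by
    intro q
    have := hle 1 h1F q q
    simpa [Set.preimage] using this
  calc ∫⁻ y, ‖n.sum fun i a => a * f i.1 (s (ψ (i.2 • y)))‖ₑ ∂ν
      ≤ ∫⁻ y, ‖L (s (ψ y))‖ₑ + Bad.indicator (fun _ => (C : ℝ≥0∞)) y ∂ν := by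
        refine lintegral_mono fun y => ?_
        by_cases hy : y ∈ Bad
        · rw [Set.indicator_of_mem hy]
          exact (hC n hn fun i => s (ψ (i.2 • y))).trans le_add_self
        · rw [Set.indicator_of_notMem hy, add_zero]
          exact (congr_arg _ (hgood y hy)).le
    _ = ∫⁻ y, ‖L (s (ψ y))‖ₑ ∂ν + C * ν Bad := by
        rw [lintegral_add_right _ (measurable_const.indicator hBadm),
          lintegral_indicator_const hBadm]
    _ = ∑ q, ‖L (s q)‖ₑ * ν (ψ ⁻¹' {q}) + C * ν Bad := by
        rw [← lintegral_map (f := fun q => ‖L (s q)‖ₑ) (measurable_of_finite _) hψ,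
          lintegral_fintype]
        simp only [Measure.map_apply hψ (measurableSet_singleton _)]
    _ ≤ ∑ q, (‖L (s q)‖ₑ * μ (φ ⁻¹' {q}) + C * δ) + C * (F.card * (k * k) * δ) := by
        gcongr with q
        refine (mul_le_mul_right (hfib q) _).trans ?_
        rw [mul_add]
        gcongr
        exact hC n hn fun i => i.2 • s q
    _ = ∫⁻ x, ‖L (s (φ x))‖ₑ ∂μ + T * δ := by
        rw [← lintegral_map (f := fun q => ‖L (s q)‖ₑ) (measurable_of_finite _) hφm,
          lintegral_fintype]
        simp only [Measure.map_apply hφm (measurableSet_singleton _)]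
        rw [Finset.sum_add_distrib, Finset.sum_const, Finset.card_univ, nsmul_eq_mul, hT]
        ring
    _ ≤ ∫⁻ x, ‖L x‖ₑ ∂μ + ε := by
        simp only [hLs]
        gcongr
        exact ENNReal.mul_div_le

end WeakContainment

/-! ### From pointwise functions to classes in `L^∞` -/

section BoundedFunctions

variable {Γ : Type*} [Group Γ] {X : Type*} [MeasurableSpace X] [MulAction Γ X]
  [MeasurableConstSMul Γ X] {μ : Measure X} [SMulInvariantMeasure Γ X μ]

/-- Elements of `L^∞(X, μ; ℤ)` have everywhere bounded measurable representatives; for the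
constant function `1` we can take the constant representative. -/
theorem exists_bounded_representative {X : Type*} [MeasurableSpace X] {μ : Measure X}
    [IsProbabilityMeasure μ] (f : LinfInt μ) :
    ∃ (r : X → ℤ) (K : ℕ), Measurable r ∧ (∀ x, (r x).natAbs ≤ K) ∧ f =ᵐ[μ] r ∧
      (f = Lp.const ∞ μ (1 : ℤ) → ∀ x, r x = 1) := by
  -- The constant `1` is treated separately so that it is transported exactly, not just almost
  -- everywhere on `X`: `t` may land in a null set.
  by_cases hf : f = Lp.const ∞ μ (1 : ℤ)
  · exact ⟨fun _ => 1, 1, measurable_const, fun _ => by simp, hf ▸ Lp.coeFn_const _ _ _,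
      fun _ _ => rfl⟩
  · obtain ⟨r, hr, hfr⟩ := (Lp.aestronglyMeasurable f).aemeasurable
    obtain ⟨K, hK⟩ := exists_nat_ge (eLpNormEssSup f μ).toReal
    have htop : eLpNormEssSup f μ ≠ ∞ := by
      rw [← eLpNorm_exponent_top]
      exact Lp.eLpNorm_ne_top f
    -- Clamping to `[-K, K]` changes the representative only on a null set, as `K` exceeds the
    -- essential supremum.
    refine ⟨fun x => max (-(K : ℤ)) (min (r x) K), K, measurable_const.max (hr.min measurable_const),
      fun x => by dsimp only; omega, ?_, fun h => absurd h hf⟩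
    filter_upwards [hfr, ae_le_eLpNormEssSup (f := f) (μ := μ)] with x h1 h2
    have h3 : ‖f x‖ ≤ K := by
      rw [← toReal_enorm]
      exact (ENNReal.toReal_mono htop h2).trans hK
    rw [h1, Int.norm_eq_abs] at h3
    have h4 : |r x| ≤ K := by exact_mod_cast h3
    have := abs_le.mp h4
    rw [h1]
    omega

/-- Evaluation of a formal linear combination of translates. -/
def evalTranslates {J A : Type*} [AddCommGroup A] [DistribMulAction Γᵈᵐᵃ A] (f : J → A) :
    (J × Γ →₀ ℤ) →ₗ[ℤ] A :=
  Finsupp.linearCombination ℤ fun i : J × Γ => DomMulAct.mk i.2 • f i.1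

theorem evalTranslates_single {J A : Type*} [AddCommGroup A] [DistribMulAction Γᵈᵐᵃ A]
    (f : J → A) (j : J) (g : Γ) (a : ℤ) :
    evalTranslates f (Finsupp.single (j, g) a) = a • DomMulAct.mk g • f j := by
  simp [evalTranslates]

/-- Links combinations in `L^∞` with the pointwise ones of the coding argument. Invariance of `μ`
lets the almost everywhere equalities survive translation. -/
theorem evalTranslates_ae_eq {J : Type*} {f : J → LinfInt μ} {r : J → X → ℤ}
    (h : ∀ j, f j =ᵐ[μ] r j) (n : J × Γ →₀ ℤ) :
    evalTranslates f n =ᵐ[μ] fun x => n.sum fun i a => a * r i.1 (i.2 • x) := by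
  classical
  induction n using Finsupp.induction_linear with
  | zero =>
    simp only [map_zero, Finsupp.sum_zero_index]
    exact Lp.coeFn_zero _ _ _
  | add n n' hn hn' =>
    rw [map_add]
    filter_upwards [hn, hn', Lp.coeFn_add (evalTranslates f n) (evalTranslates f n')]
      with x h1 h2 h3
    rw [h3, Pi.add_apply, h1, h2, Finsupp.sum_add_index' (by simp) (by intros; ring)]
  | single i a =>
    obtain ⟨j, g⟩ := i
    rw [evalTranslates_single]
    have h1 := (measurePreserving_smul g μ).quasiMeasurePreserving.ae_eq_comp (h j)
    filter_upwards [h1, DomMulAct.smul_Lp_ae_eq (DomMulAct.mk g) (f j),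
      Lp.coeFn_smul a (DomMulAct.mk g • f j)] with x h1 h2 h3
    simp only [Function.comp_apply] at h1
    simp only [zero_mul, Finsupp.sum_single_index]
    rw [← h1]
    refine Eq.trans ?_ (h3.trans ?_)
    · rfl
    · rw [Pi.smul_apply, h2, smul_eq_mul]
      rfl

end BoundedFunctions

/-- Weak containment allows to transport finite families in `L^∞(X, μ; ℤ)`, such that the
`L¹`-norms of finitely many given linear combinations of translates hardly increase. -/
theorem WeaklyContained.exists_transfer {Γ : Type*} [Group Γ]
    {X : Type*} [MeasurableSpace X] [MulAction Γ X] [MeasurableConstSMul Γ X]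
    {μ : Measure X} [IsProbabilityMeasure μ] [SMulInvariantMeasure Γ X μ]
    {Y : Type*} [MeasurableSpace Y] [MulAction Γ Y] [MeasurableConstSMul Γ Y]
    {ν : Measure Y} [IsProbabilityMeasure ν] [SMulInvariantMeasure Γ Y ν]
    (h : WeaklyContained Γ μ ν) {J : Type*} [Fintype J] (f : J → LinfInt μ)
    (N : Finset (J × Γ →₀ ℤ)) {ε : ℝ≥0∞} (hε : ε ≠ 0) :
    ∃ f' : J → LinfInt ν,
      (∀ j, f j = Lp.const ∞ μ (1 : ℤ) → f' j = Lp.const ∞ ν (1 : ℤ)) ∧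
      ∀ n ∈ N, ∫⁻ y, ‖evalTranslates f' n y‖ₑ ∂ν ≤ ∫⁻ x, ‖evalTranslates f n x‖ₑ ∂μ + ε := by
  choose r K hr hK hfr hone using fun j => exists_bounded_representative (f j)
  have hK' : ∀ j x, (r j x).natAbs ≤ ∑ i, K i := fun j x =>
    (hK j x).trans (Finset.single_le_sum (fun _ _ => Nat.zero_le _) (Finset.mem_univ j))
  obtain ⟨t, ht, hle⟩ := h.exists_coding_lintegral_le hr hK' N hε
  have hmem : ∀ j, MemLp (fun y => r j (t y)) ∞ ν := fun j =>
    memLp_top_of_bound (ht j).aestronglyMeasurable (K j) <| Filter.Eventually.of_forall fun y => by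
      rw [Int.norm_eq_abs]
      have := hK j (t y)
      have h2 : |r j (t y)| ≤ K j := by rw [Int.abs_eq_natAbs]; exact_mod_cast this
      exact_mod_cast h2
  have hcoe : ∀ j, (hmem j).toLp =ᵐ[ν] fun y => r j (t y) := fun j => (hmem j).coeFn_toLp
  refine ⟨fun j => (hmem j).toLp, fun j hj => ?_, fun n hn => ?_⟩
  · refine Lp.ext ((hcoe j).trans ?_)
    filter_upwards [Lp.coeFn_const ∞ ν (1 : ℤ)] with y hy
    rw [hy, hone j hj]
    rfl
  · have h1 : ∫⁻ y, ‖evalTranslates (fun j => (hmem j).toLp) n y‖ₑ ∂ν =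
        ∫⁻ y, ‖n.sum fun i a => a * r i.1 (t (i.2 • y))‖ₑ ∂ν := by
      refine lintegral_congr_ae ?_
      filter_upwards [evalTranslates_ae_eq hcoe n] with y hy
      rw [hy]
    have h2 : ∫⁻ x, ‖evalTranslates f n x‖ₑ ∂μ =
        ∫⁻ x, ‖n.sum fun i a => a * r i.1 (i.2 • x)‖ₑ ∂μ := by
      refine lintegral_congr_ae ?_
      filter_upwards [evalTranslates_ae_eq hfr n] with y hy
      rw [hy]
    rw [h1, h2]
    exact hle n hn

/-! ### Deck transformations acting on singular simplices -/

section Deck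

namespace IsUniversalCovering

variable {Γ : Type*} [Group Γ] {E M : Type*} [TopologicalSpace E] [TopologicalSpace M]
  [MulAction Γ E] {p : E → M}

theorem map_smul (hp : IsUniversalCovering Γ p) (g : Γ) (e : E) : p (g • e) = p e :=
  hp.deck.apply_eq_iff_mem_orbit.mpr ⟨g, rfl⟩

theorem smul_eq_self (hp : IsUniversalCovering Γ p) {g : Γ} {e : E} (h : g • e = e) : g = 1 := by
  obtain ⟨U, hU, hg⟩ := hp.deck.disjoint e
  exact hg g ⟨e, ⟨e, mem_of_mem_nhds hU, h⟩, mem_of_mem_nhds hU⟩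

end IsUniversalCovering

variable {Γ : Type*} [Group Γ] {n : ℕ} {E M : Type*} [TopologicalSpace E] [TopologicalSpace M]
  [MulAction Γ E] [ContinuousConstSMul Γ E] {p : C(E, M)}

/-- The translate `g • σ` of a singular simplex. -/
def translateSimplex (g : Γ) (σ : SingularSimplex n E) : SingularSimplex n E :=
  (⟨fun y => g • y, continuous_const_smul g⟩ : C(E, E)).comp σ

theorem translateSimplex_mul (g h : Γ) (σ : SingularSimplex n E) :
    translateSimplex (g * h) σ = translateSimplex g (translateSimplex h σ) :=
  ContinuousMap.ext fun t => mul_smul g h (σ t)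

theorem translate_single (g : Γ) (σ : SingularSimplex n E) (a : ℤ) :
    translate n g (Finsupp.single σ a) = Finsupp.single (translateSimplex g σ) a :=
  chainMap_single _ σ a

namespace IsUniversalCovering

variable (hp : IsUniversalCovering Γ p)

include hp

theorem comp_translateSimplex (g : Γ) (σ : SingularSimplex n E) :
    p.comp (translateSimplex g σ) = p.comp σ :=
  ContinuousMap.ext fun t => hp.map_smul g (σ t)

/-- Two singular simplices with the same projection differ by a deck transformation. -/
theorem exists_translateSimplex_eq {σ τ : SingularSimplex n E} (h : p.comp σ = p.comp τ) :
    ∃ g : Γ, translateSimplex g τ = σ := by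
  obtain ⟨t⟩ : Nonempty (Simplex n) := inferInstance
  obtain ⟨g, hg⟩ := hp.deck.apply_eq_iff_mem_orbit.mp (DFunLike.congr_fun h t)
  -- The two lifts agree at `t` after translation by `g`, hence everywhere, since the simplex is
  -- connected.
  refine ⟨g, DFunLike.coe_injective (hp.covering.eq_of_comp_eq (map_continuous _)
    (map_continuous _) ?_ t hg)⟩
  exact congr_arg DFunLike.coe ((hp.comp_translateSimplex g τ).trans h.symm)

theorem translateSimplex_injective (σ : SingularSimplex n E) :
    Function.Injective fun g : Γ => translateSimplex g σ := by
  intro g h hgh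
  obtain ⟨t⟩ : Nonempty (Simplex n) := inferInstance
  have h1 : g • σ t = h • σ t := DFunLike.congr_fun hgh t
  have h2 : (h⁻¹ * g) • σ t = σ t := by rw [mul_smul, h1, inv_smul_smul]
  exact (inv_mul_eq_one.mp (hp.smul_eq_self h2)).symm

end IsUniversalCovering

variable (p) in
/-- A chosen representative of the singular simplices of `E` with the same projection as `σ`. -/
def orbitRep (σ : SingularSimplex n E) : SingularSimplex n E :=
  -- The choice depends only on `p.comp σ`, so it is constant on orbits.
  Function.surjInv (f := Set.rangeFactorization fun τ : SingularSimplex n E => p.comp τ)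
    Set.rangeFactorization_surjective ⟨p.comp σ, σ, rfl⟩

theorem comp_orbitRep (σ : SingularSimplex n E) : p.comp (orbitRep p σ) = p.comp σ :=
  congr_arg Subtype.val (Function.surjInv_eq
    (f := Set.rangeFactorization fun τ : SingularSimplex n E => p.comp τ)
    Set.rangeFactorization_surjective ⟨p.comp σ, σ, rfl⟩)

theorem orbitRep_congr {σ τ : SingularSimplex n E} (h : p.comp σ = p.comp τ) :
    orbitRep p σ = orbitRep p τ := by
  simp only [orbitRep, h]

theorem orbitRep_orbitRep (σ : SingularSimplex n E) :
    orbitRep p (orbitRep p σ) = orbitRep p σ :=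
  orbitRep_congr (comp_orbitRep σ)

/-- The deck transformation carrying the chosen representative to `σ`. -/
def deckElement (hp : IsUniversalCovering Γ p) (σ : SingularSimplex n E) : Γ :=
  (hp.exists_translateSimplex_eq (comp_orbitRep (p := p) σ).symm).choose

theorem translateSimplex_deckElement (hp : IsUniversalCovering Γ p) (σ : SingularSimplex n E) :
    translateSimplex (deckElement hp σ) (orbitRep p σ) = σ :=
  (hp.exists_translateSimplex_eq (comp_orbitRep (p := p) σ).symm).choose_spec

theorem orbitRep_translateSimplex (hp : IsUniversalCovering Γ p) (g : Γ)
    (σ : SingularSimplex n E) : orbitRep p (translateSimplex g σ) = orbitRep p σ :=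
  orbitRep_congr (hp.comp_translateSimplex g σ)

/-- By freeness: both elements carry `orbitRep p σ` to `translateSimplex g σ`. -/
theorem deckElement_translateSimplex (hp : IsUniversalCovering Γ p) (g : Γ)
    (σ : SingularSimplex n E) :
    deckElement hp (translateSimplex g σ) = g * deckElement hp σ := by
  refine hp.translateSimplex_injective (orbitRep p σ) ?_
  dsimp only
  rw [translateSimplex_mul, translateSimplex_deckElement, ← orbitRep_translateSimplex hp g,
    translateSimplex_deckElement]

end Deck

/-! ### Coordinates of twisted chains -/

section Coordinates

variable {Γ : Type*} [Group Γ] {A : Type*} [AddCommGroup A] [DistribMulAction Γᵈᵐᵃ A]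
  {n : ℕ} {E M : Type*} [TopologicalSpace E] [TopologicalSpace M]
  [MulAction Γ E] [ContinuousConstSMul Γ E] {p : C(E, M)}

theorem tmul_add_left (f f' : A) (c : Chain n E) :
    tmul Γ (f + f') c = tmul Γ f c + tmul Γ f' c := by
  simp [tmul, TensorProduct.add_tmul]

theorem tmul_add_right (f : A) (c c' : Chain n E) :
    tmul Γ f (c + c') = tmul Γ f c + tmul Γ f c' := by
  simp [tmul, TensorProduct.tmul_add]

theorem tmul_zero_left (c : Chain n E) : tmul Γ (0 : A) c = 0 := by
  simp [tmul]

theorem tmul_zero_right (f : A) : tmul Γ f (0 : Chain n E) = 0 := by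
  simp [tmul]

theorem tmul_single (f : A) (σ : SingularSimplex n E) (a : ℤ) :
    tmul Γ f (Finsupp.single σ a) = tmul Γ (a • f) (Finsupp.single σ 1) := by
  rw [tmul, tmul, TensorProduct.smul_tmul, Finsupp.smul_single, smul_eq_mul, mul_one]

/-- Twisted chains are sums of elementary tensors `f ⊗ σ`. -/
theorem TwistedChain.induction_on {P : TwistedChain Γ A n E → Prop} (c : TwistedChain Γ A n E)
    (zero : P 0) (single : ∀ (f : A) (σ : SingularSimplex n E), P (tmul Γ f (Finsupp.single σ 1)))
    (add : ∀ c c', P c → P c' → P (c + c')) : P c := by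
  obtain ⟨c, rfl⟩ := QuotientAddGroup.mk_surjective c
  induction c using TensorProduct.induction_on with
  | zero => exact zero
  | add c c' hc hc' => exact add _ _ hc hc'
  | tmul f c =>
    change P (tmul Γ f c)
    induction c using Finsupp.induction_linear with
    | zero => rwa [tmul_zero_right]
    | add c c' hc hc' => rw [tmul_add_right]; exact add _ _ hc hc'
    | single σ a => rw [tmul_single]; exact single _ _

theorem TwistedChain.exists_eq_sum (c : TwistedChain Γ A n E) :
    ∃ (k : ℕ) (f : Fin k → A) (σ : Fin k → SingularSimplex n E),
      c = ∑ j, tmul Γ (f j) (Finsupp.single (σ j) 1) := by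
  induction c using TwistedChain.induction_on with
  | zero => exact ⟨0, Fin.elim0, Fin.elim0, by simp⟩
  | single f σ => exact ⟨1, fun _ => f, fun _ => σ, by simp⟩
  | add c c' hc hc' =>
    obtain ⟨k, f, σ, rfl⟩ := hc
    obtain ⟨k', f', σ', rfl⟩ := hc'
    exact ⟨k + k', Fin.append f f', Fin.append σ σ', by simp [Fin.sum_univ_add]⟩

variable (A) in
/-- The coordinates of `f ⊗ c` with respect to the chosen representatives, as a bilinear map. -/
def coordAux (hp : IsUniversalCovering Γ p) (n : ℕ) :
    Chain n E →ₗ[ℤ] A →ₗ[ℤ] (SingularSimplex n E →₀ A) :=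
  Finsupp.linearCombination ℤ fun σ : SingularSimplex n E =>
    (Finsupp.lsingle (orbitRep p σ) : A →ₗ[ℤ] (SingularSimplex n E →₀ A)) ∘ₗ
      (DistribSMul.toAddMonoidHom A (DomMulAct.mk (deckElement hp σ))).toIntLinearMap

theorem coordAux_single (hp : IsUniversalCovering Γ p) (σ : SingularSimplex n E) (a : ℤ) (f : A) :
    coordAux A hp n (Finsupp.single σ a) f =
      Finsupp.single (orbitRep p σ) (a • DomMulAct.mk (deckElement hp σ) • f) := by
  simp [coordAux]

/-- The relation needed to descend to the tensor product over `ℤΓ`. Since `Γᵈᵐᵃ` reverses products,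
`g * deckElement hp σ` acts by `g` first. -/
theorem coordAux_translate (hp : IsUniversalCovering Γ p) (g : Γ) (f : A) (c : Chain n E) :
    coordAux A hp n (translate n g c) f = coordAux A hp n c (DomMulAct.mk g • f) := by
  induction c using Finsupp.induction_linear with
  | zero => simp
  | add c c' hc hc' => simp only [map_add, LinearMap.add_apply, hc, hc']
  | single σ a =>
    rw [translate_single, coordAux_single, coordAux_single, orbitRep_translateSimplex hp,
      deckElement_translateSimplex, smul_smul (DomMulAct.mk (deckElement hp σ)),
      ← DomMulAct.mk_mul]

variable (A) in
/-- The coordinates of a twisted chain with respect to the chosen representatives of the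
`Γ`-orbits of singular simplices. -/
def coord (hp : IsUniversalCovering Γ p) (n : ℕ) :
    TwistedChain Γ A n E →+ (SingularSimplex n E →₀ A) :=
  QuotientAddGroup.lift _ (TensorProduct.lift (coordAux A hp n).flip).toAddMonoidHom <| by
    rw [balancing, AddSubgroup.closure_le]
    rintro _ ⟨g, f, c, rfl⟩
    simp [coordAux_translate]

theorem coord_tmul (hp : IsUniversalCovering Γ p) (f : A) (c : Chain n E) :
    coord A hp n (tmul Γ f c) = coordAux A hp n c f := rfl

theorem coord_tmul_single (hp : IsUniversalCovering Γ p) (f : A) (σ : SingularSimplex n E) :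
    coord A hp n (tmul Γ f (Finsupp.single σ 1)) =
      Finsupp.single (orbitRep p σ) (DomMulAct.mk (deckElement hp σ) • f) := by
  rw [coord_tmul, coordAux_single, one_smul]

/-- Writing `σ = g • ρ` with `ρ` the chosen representative gives `f ⊗ σ = f · g ⊗ ρ`. Hence the
coordinates determine the chain. -/
theorem sum_coord (hp : IsUniversalCovering Γ p) (c : TwistedChain Γ A n E) :
    ((coord A hp n c).sum fun ρ f => tmul Γ f (Finsupp.single ρ 1)) = c := by
  classical
  induction c using TwistedChain.induction_on with
  | zero => simp
  | add c c' hc hc' =>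
    rw [map_add, Finsupp.sum_add_index' (h := fun ρ f => tmul Γ f (Finsupp.single ρ 1))
      (fun _ => tmul_zero_left _) (fun _ _ _ => tmul_add_left _ _ _), hc, hc']
  | single f σ =>
    rw [coord_tmul_single, Finsupp.sum_single_index
      (h := fun ρ f => tmul Γ f (Finsupp.single ρ 1)) (tmul_zero_left _), tmul_smul_left,
      translate_single, translateSimplex_deckElement]

theorem orbitRep_of_mem_support_coord (hp : IsUniversalCovering Γ p) (c : TwistedChain Γ A n E)
    {ρ : SingularSimplex n E} (hρ : ρ ∈ (coord A hp n c).support) : orbitRep p ρ = ρ := by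
  classical
  induction c using TwistedChain.induction_on with
  | zero => simp at hρ
  | add c c' hc hc' =>
    rw [map_add] at hρ
    exact (Finset.mem_union.mp (Finsupp.support_add hρ)).elim hc hc'
  | single f σ =>
    rw [coord_tmul_single] at hρ
    rw [Finset.mem_singleton.mp (Finsupp.support_single_subset hρ), orbitRep_orbitRep]

/-- The coordinates of `∑ⱼ fⱼ ⊗ cⱼ` are linear combinations of translates of the `fⱼ`, with
coefficients that do not depend on the `fⱼ`. -/
def coordCoeff (hp : IsUniversalCovering Γ p) {J : Type*} [Fintype J] (c : J → Chain n E)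
    (ρ : SingularSimplex n E) : J × Γ →₀ ℤ :=
  open Classical in
  ∑ j, (c j).sum fun σ a => if orbitRep p σ = ρ then Finsupp.single (j, deckElement hp σ) a else 0

theorem coordAux_apply (hp : IsUniversalCovering Γ p) (c : Chain n E) (f : A)
    (ρ : SingularSimplex n E) [DecidableEq (SingularSimplex n E)] :
    coordAux A hp n c f ρ =
      c.sum fun σ a => if orbitRep p σ = ρ then a • DomMulAct.mk (deckElement hp σ) • f else 0 := by
  induction c using Finsupp.induction_linear with
  | zero => simp
  | add c c' hc hc' =>
    rw [map_add, LinearMap.add_apply, Finsupp.add_apply, hc, hc', Finsupp.sum_add_index']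
    · simp
    · intros; split_ifs <;> simp [add_smul]
  | single σ a =>
    rw [coordAux_single, Finsupp.sum_single_index (by simp), Finsupp.single_apply]

/-- The point is that `coordCoeff` does not involve the module `A`: the same formal combinations
compute the coordinates over `X` and over `Y`. -/
theorem coord_sum_tmul_apply (hp : IsUniversalCovering Γ p) {J : Type*} [Fintype J]
    (c : J → Chain n E) (f : J → A) (ρ : SingularSimplex n E) :
    coord A hp n (∑ j, tmul Γ (f j) (c j)) ρ = evalTranslates f (coordCoeff hp c ρ) := by
  classical
  rw [map_sum, Finsupp.finsetSum_apply, coordCoeff, map_sum]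
  refine Finset.sum_congr rfl fun j _ => ?_
  rw [coord_tmul, coordAux_apply, map_finsuppSum]
  refine Finsupp.sum_congr fun σ _ => ?_
  split_ifs
  · rw [evalTranslates_single]
  · rw [map_zero]

theorem exists_finset_coordCoeff_eq_zero (hp : IsUniversalCovering Γ p) {J : Type*} [Fintype J]
    (c : J → Chain n E) : ∃ S : Finset (SingularSimplex n E), ∀ ρ ∉ S, coordCoeff hp c ρ = 0 := by
  classical
  refine ⟨Finset.univ.biUnion fun j => (c j).support.image (orbitRep p), fun ρ hρ => ?_⟩
  refine Finset.sum_eq_zero fun j _ => Finset.sum_eq_zero fun σ hσ => if_neg ?_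
  rintro rfl
  exact hρ (Finset.mem_biUnion.mpr ⟨j, Finset.mem_univ j, Finset.mem_image_of_mem _ hσ⟩)

/-- If `f` is `Γ`-invariant, then `f ⊗ c` only depends on the projection of `c` to `M`. -/
theorem tmul_eq_zero_of_chainMap_eq_zero (hp : IsUniversalCovering Γ p) {f : A}
    (hf : ∀ g : Γ, DomMulAct.mk g • f = f) {c : Chain n E} (hc : chainMap n p c = 0) :
    tmul Γ f c = 0 := by
  classical
  -- With invariant `f` the factor `deckElement` disappears, and the coordinates can be read off the
  -- projection; by `orbitRep_congr` the choice of lift does not matter.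
  have key : ∀ c : Chain n E, coordAux A hp n c f =
      (chainMap n p c).sum fun s a =>
        if h : ∃ σ, p.comp σ = s then Finsupp.single (orbitRep p h.choose) (a • f) else 0 := by
    intro c
    induction c using Finsupp.induction_linear with
    | zero => simp
    | add c c' hc hc' =>
      rw [map_add, map_add, LinearMap.add_apply, hc, hc', Finsupp.sum_add_index']
      · simp
      · intros; split_ifs <;> simp [add_smul]
    | single σ a =>
      have h : ∃ τ : SingularSimplex n E, p.comp τ = p.comp σ := ⟨σ, rfl⟩
      rw [chainMap_single, Finsupp.sum_single_index (by simp), coordAux_single, hf, dif_pos h,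
        orbitRep_congr h.choose_spec]
  rw [← sum_coord hp (tmul Γ f c), coord_tmul, key, hc, Finsupp.sum_zero_index,
    Finsupp.sum_zero_index]

end Coordinates

/-! ### The `ℓ¹`-norm in coordinates -/

section Norm

variable {Γ : Type*} [Group Γ] {n : ℕ} {E M : Type*} [TopologicalSpace E] [TopologicalSpace M]
  [MulAction Γ E] [ContinuousConstSMul Γ E] {p : C(E, M)}
  {X : Type*} [MeasurableSpace X] [MulAction Γ X] [MeasurableConstSMul Γ X]
  {μ : Measure X} [SMulInvariantMeasure Γ X μ]

theorem lintegral_enorm_zero {X : Type*} [MeasurableSpace X] {μ : Measure X} :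
    ∫⁻ x, ‖(0 : LinfInt μ) x‖ₑ ∂μ = 0 := by
  rw [← lintegral_zero (μ := μ)]
  refine lintegral_congr_ae ?_
  filter_upwards [Lp.coeFn_zero ℤ ∞ μ] with x hx
  rw [hx, Pi.zero_apply, enorm_zero]

theorem lintegral_enorm_add_le {X : Type*} [MeasurableSpace X] {μ : Measure X}
    (f f' : LinfInt μ) :
    ∫⁻ x, ‖(f + f') x‖ₑ ∂μ ≤ ∫⁻ x, ‖f x‖ₑ ∂μ + ∫⁻ x, ‖f' x‖ₑ ∂μ := by
  rw [← lintegral_add_left' (Lp.aestronglyMeasurable f).enorm]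
  refine lintegral_mono_ae ?_
  filter_upwards [Lp.coeFn_add f f'] with x hx
  rw [hx]
  exact enorm_add_le _ _

theorem lintegral_enorm_sum_le {X : Type*} [MeasurableSpace X] {μ : Measure X} {ι : Type*}
    (s : Finset ι) (f : ι → LinfInt μ) :
    ∫⁻ x, ‖(∑ i ∈ s, f i) x‖ₑ ∂μ ≤ ∑ i ∈ s, ∫⁻ x, ‖f i x‖ₑ ∂μ :=
  Finset.le_sum_of_subadditive (fun f : LinfInt μ => ∫⁻ x, ‖f x‖ₑ ∂μ) lintegral_enorm_zero.le
    lintegral_enorm_add_le s f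

theorem lintegral_enorm_smul (g : Γ) (f : LinfInt μ) :
    ∫⁻ x, ‖(DomMulAct.mk g • f) x‖ₑ ∂μ = ∫⁻ x, ‖f x‖ₑ ∂μ := by
  have h1 : ∫⁻ x, ‖(DomMulAct.mk g • f) x‖ₑ ∂μ = ∫⁻ x, ‖f (g • x)‖ₑ ∂μ := by
    refine lintegral_congr_ae ?_
    filter_upwards [DomMulAct.smul_Lp_ae_eq (DomMulAct.mk g) f] with x hx
    rw [hx]
    rfl
  rw [h1]
  exact (measurePreserving_smul g μ).lintegral_comp (Lp.stronglyMeasurable f).measurable.enorm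

/-- The norm of the coordinates is a lower bound for the `ℓ¹`-norm. -/
theorem sum_coord_le_l1Norm (hp : IsUniversalCovering Γ p) (c : ParamChain Γ μ n E)
    (S : Finset (SingularSimplex n E)) :
    ∑ ρ ∈ S, ∫⁻ x, ‖coord (LinfInt μ) hp n c ρ x‖ₑ ∂μ ≤ l1Norm Γ p μ c := by
  classical
  refine le_iInf fun k => le_iInf fun f => le_iInf fun σ => le_iInf fun h => ?_
  -- Each `f j` contributes, up to a norm-preserving translation, to the single coordinate at
  -- `orbitRep p (σ j)`; the triangle inequality does the rest.
  rw [h.2, map_sum]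
  calc ∑ ρ ∈ S, ∫⁻ x,
        ‖(∑ j, coord (LinfInt μ) hp n (tmul Γ (f j) (Finsupp.single (σ j) 1))) ρ x‖ₑ ∂μ
      ≤ ∑ ρ ∈ S, ∑ j, if orbitRep p (σ j) = ρ then ∫⁻ x, ‖f j x‖ₑ ∂μ else 0 := by
        refine Finset.sum_le_sum fun ρ _ => ?_
        rw [Finsupp.finsetSum_apply]
        refine (lintegral_enorm_sum_le _ _).trans_eq (Finset.sum_congr rfl fun j _ => ?_)
        rw [coord_tmul_single, Finsupp.single_apply]
        split_ifs
        · exact lintegral_enorm_smul _ _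
        · exact lintegral_enorm_zero
    _ = ∑ j, ∑ ρ ∈ S, if orbitRep p (σ j) = ρ then ∫⁻ x, ‖f j x‖ₑ ∂μ else 0 := Finset.sum_comm
    _ ≤ ∑ j, ∫⁻ x, ‖f j x‖ₑ ∂μ := by
        refine Finset.sum_le_sum fun j _ => ?_
        rw [Finset.sum_ite_eq]
        split_ifs
        · exact le_rfl
        · exact zero_le

/-- The norm of the coordinates is an upper bound for the `ℓ¹`-norm. -/
theorem l1Norm_le_sum_coord (hp : IsUniversalCovering Γ p) (c : ParamChain Γ μ n E)
    {S : Finset (SingularSimplex n E)} (hS : ∀ ρ ∉ S, coord (LinfInt μ) hp n c ρ = 0) :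
    l1Norm Γ p μ c ≤ ∑ ρ ∈ S, ∫⁻ x, ‖coord (LinfInt μ) hp n c ρ x‖ₑ ∂μ := by
  classical
  set u := coord (LinfInt μ) hp n c with hu
  have hsub : u.support ⊆ S := fun ρ hρ => by
    by_contra h
    exact Finsupp.mem_support_iff.mp hρ (hS ρ h)
  refine le_trans ?_ (Finset.sum_le_sum_of_subset hsub)
  set e := u.support.equivFin
  -- The coordinates themselves form a reduced form: distinct chosen representatives have distinct
  -- projections.
  have hred : IsReducedForm Γ p μ c (fun j => u (e.symm j : SingularSimplex n E))
      (fun j => (e.symm j : SingularSimplex n E)) := by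
    constructor
    · intro i j hij
      have h1 := orbitRep_congr hij
      rw [orbitRep_of_mem_support_coord hp c (e.symm i).2,
        orbitRep_of_mem_support_coord hp c (e.symm j).2] at h1
      exact e.symm.injective (Subtype.ext h1)
    · conv_lhs => rw [← sum_coord hp c]
      rw [Finsupp.sum, ← Finset.sum_coe_sort]
      exact (Equiv.sum_comp e.symm fun ρ : u.support =>
        tmul Γ (u ρ) (Finsupp.single (ρ : SingularSimplex n E) 1)).symm
  refine (iInf₂_le_of_le _ _ (iInf₂_le _ hred)).trans_eq ?_
  rw [← Finset.sum_coe_sort u.support]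
  exact Equiv.sum_comp e.symm fun ρ : u.support => ∫⁻ x, ‖u ρ x‖ₑ ∂μ

end Norm

/-! ### Transport of parametrized fundamental cycles -/

section Comparison

variable {Γ : Type*} [Group Γ] {n : ℕ} {E M : Type*} [TopologicalSpace E] [TopologicalSpace M]
  [MulAction Γ E] [ContinuousConstSMul Γ E] {p : C(E, M)}
  {X : Type*} [MeasurableSpace X] [MulAction Γ X] [MeasurableConstSMul Γ X]
  {μ : Measure X} [IsProbabilityMeasure μ] [SMulInvariantMeasure Γ X μ]
  {Y : Type*} [MeasurableSpace Y] [MulAction Γ Y] [MeasurableConstSMul Γ Y]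
  {ν : Measure Y} [IsProbabilityMeasure ν] [SMulInvariantMeasure Γ Y ν]

/-- Weak containment allows to transport the coefficients of a parametrized chain, such that the
`ℓ¹`-norm hardly increases. -/
theorem WeaklyContained.exists_l1Norm_le (h : WeaklyContained Γ μ ν)
    (hp : IsUniversalCovering Γ p) {J : Type*} [Fintype J] (f : J → LinfInt μ)
    (c : J → Chain n E) {ε : ℝ≥0∞} (hε : ε ≠ 0) :
    ∃ f' : J → LinfInt ν,
      (∀ j, f j = Lp.const ∞ μ (1 : ℤ) → f' j = Lp.const ∞ ν (1 : ℤ)) ∧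
      l1Norm Γ p ν (∑ j, tmul Γ (f' j) (c j)) ≤ l1Norm Γ p μ (∑ j, tmul Γ (f j) (c j)) + ε := by
  classical
  -- `S` comes from the chains `c` alone, so it serves both actions; each of its coordinates may
  -- cost `ε / S.card`.
  obtain ⟨S, hS⟩ := exists_finset_coordCoeff_eq_zero hp c
  obtain ⟨f', hone, hle⟩ := h.exists_transfer f (S.image (coordCoeff hp c))
    (ENNReal.div_pos hε (ENNReal.natCast_ne_top S.card)).ne'
  refine ⟨f', hone, ?_⟩
  calc l1Norm Γ p ν (∑ j, tmul Γ (f' j) (c j))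
      ≤ ∑ ρ ∈ S, ∫⁻ y, ‖coord (LinfInt ν) hp n (∑ j, tmul Γ (f' j) (c j)) ρ y‖ₑ ∂ν :=
        l1Norm_le_sum_coord hp _ fun ρ hρ => by rw [coord_sum_tmul_apply, hS ρ hρ, map_zero]
    _ ≤ ∑ ρ ∈ S, (∫⁻ x, ‖coord (LinfInt μ) hp n (∑ j, tmul Γ (f j) (c j)) ρ x‖ₑ ∂μ
          + ε / S.card) := by
        refine Finset.sum_le_sum fun ρ hρ => ?_
        rw [coord_sum_tmul_apply, coord_sum_tmul_apply]
        exact hle _ (Finset.mem_image_of_mem _ hρ)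
    _ ≤ l1Norm Γ p μ (∑ j, tmul Γ (f j) (c j)) + ε := by
        rw [Finset.sum_add_distrib, Finset.sum_const, nsmul_eq_mul]
        exact add_le_add (sum_coord_le_l1Norm hp _ S) ENNReal.mul_div_le

theorem boundary_eq_zero_of_mem_relCycles_empty {T : Type*} [TopologicalSpace T]
    {z : Chain (n + 1) T} (hz : z ∈ relCycles (n + 1) (∅ : Set T)) : boundary n T z = 0 := by
  have h1 : boundary n T z ∈ chainsIn n (∅ : Set T) := hz
  have h2 : {σ : SingularSimplex n T | Set.range σ ⊆ ∅} = ∅ := by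
    ext σ
    obtain ⟨t⟩ : Nonempty (Simplex n) := inferInstance
    simp
  rw [chainsIn, h2, Finsupp.supported_empty] at h1
  exact (Submodule.mem_bot ℤ).mp h1

/-- The image of an integral cycle of the base under the change of coefficients is a cycle. -/
theorem tmul_const_mem_twistedCycles (hp : IsUniversalCovering Γ p) {w : Chain n E}
    (hw : chainMap n p w ∈ relCycles n (∅ : Set M)) :
    tmul Γ (Lp.const ∞ μ (1 : ℤ)) w ∈ twistedCycles Γ (LinfInt μ) E n := by
  cases n with
  | zero => exact AddSubgroup.mem_top _
  | succ n =>
    change twistedBoundary Γ (LinfInt μ) n E _ = 0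
    rw [twistedBoundary_tmul]
    -- `boundary n E w` need not vanish, but its projection does, and the constant coefficient is
    -- `Γ`-invariant.
    refine tmul_eq_zero_of_chainMap_eq_zero hp (fun g => DomMulAct.smul_Lp_const _ _) ?_
    rw [← boundary_chainMap]
    exact boundary_eq_zero_of_mem_relCycles_empty hw

/-- The simplicial identity: two vertices can be deleted in either order. This form makes the
exchange an involution on pairs `(i, j)`, and it flips the sign in `∂∂`. -/
theorem faceInclusion_comp_faceInclusion (i : Fin (n + 3)) (j : Fin (n + 2)) :
    (faceInclusion (n + 1) i).comp (faceInclusion n j) =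
      (faceInclusion (n + 1) (i.succAbove j)).comp (faceInclusion n (j.predAbove i)) := by
  have h : i.succAbove ∘ j.succAbove =
      (i.succAbove j).succAbove ∘ (j.predAbove i).succAbove :=
    funext fun k => (Fin.succAbove_succAbove_succAbove_predAbove i j k).symm
  ext1 t
  simp only [faceInclusion, ContinuousMap.comp_apply, ContinuousMap.coe_mk,
    stdSimplex.map_comp_apply, h]

theorem boundary_boundary (T : Type*) [TopologicalSpace T] (c : Chain (n + 2) T) :
    boundary n T (boundary (n + 1) T c) = 0 := by
  induction c using Finsupp.induction_linear with
  | zero => simp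
  | add c c' hc hc' => rw [map_add, map_add, hc, hc', add_zero]
  | single σ a =>
    have h1 : ∑ i : Fin (n + 3), ∑ j : Fin (n + 2),
        Finsupp.single ((σ.comp (faceInclusion (n + 1) i)).comp (faceInclusion n j))
          ((-1 : ℤ) ^ ((i : ℕ) + (j : ℕ))) = 0 := by
      rw [← Fintype.sum_prod_type']
      refine Finset.sum_involution (fun x _ => (x.1.succAbove x.2, x.2.predAbove x.1)) ?_ ?_
        (fun _ _ => Finset.mem_univ _) ?_
      · rintro ⟨i, j⟩ -
        dsimp only
        rw [ContinuousMap.comp_assoc, ContinuousMap.comp_assoc, faceInclusion_comp_faceInclusion,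
          Fin.neg_one_pow_succAbove_add_predAbove, ← Finsupp.single_add, add_neg_cancel,
          Finsupp.single_zero]
      · rintro ⟨i, j⟩ - - h
        exact Fin.succAbove_ne i j (congr_arg Prod.fst h)
      · rintro ⟨i, j⟩ -
        simp only [Fin.succAbove_succAbove_predAbove, Fin.predAbove_predAbove_succAbove]
    rw [boundary_single, map_smul, map_sum]
    simp only [boundary_single, Finset.smul_sum (r := (-1 : ℤ) ^ _), Finsupp.smul_single,
      smul_eq_mul, ← pow_add]
    rw [h1, smul_zero]

theorem twistedBoundary_mem_twistedCycles {A : Type*} [AddCommGroup A] [DistribMulAction Γᵈᵐᵃ A]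
    (b : TwistedChain Γ A (n + 1) E) :
    twistedBoundary Γ A n E b ∈ twistedCycles Γ A E n := by
  cases n with
  | zero => exact AddSubgroup.mem_top _
  | succ n =>
    change twistedBoundary Γ A n E _ = 0
    induction b using TwistedChain.induction_on with
    | zero => simp
    | add b b' hb hb' => rw [map_add, map_add, hb, hb', add_zero]
    | single f σ =>
      rw [twistedBoundary_tmul, twistedBoundary_tmul, boundary_boundary, tmul_zero_right]

/-- Every parametrized fundamental cycle over `μ` can be approximated by one over `ν`. -/
theorem WeaklyContained.paramSimplicialVolume_le_l1Norm (h : WeaklyContained Γ μ ν)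
    (hp : IsUniversalCovering Γ p) (o : Orientation n M) {c : ParamChain Γ μ n E}
    (hc : IsParamFundamentalCycle Γ p μ o c) {ε : ℝ≥0∞} (hε : ε ≠ 0) :
    paramSimplicialVolume Γ p ν o ≤ l1Norm Γ p μ c + ε := by
  obtain ⟨-, z, _, hz, ⟨w, hwz, rfl⟩, b, hb⟩ := hc
  obtain ⟨k, f, σ, rfl⟩ := TwistedChain.exists_eq_sum b
  -- The index `none` carries `1 ⊗ w`, so `hone none` keeps its coefficient equal to `1`; the other
  -- indices carry the boundary terms.
  obtain ⟨f', hone, hle⟩ := h.exists_l1Norm_le hp (ε := ε)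
    (fun j : Option (Fin k) => j.elim (Lp.const ∞ μ (1 : ℤ)) f)
    (fun j : Option (Fin k) => j.elim w fun j => boundary n E (Finsupp.single (σ j) 1)) hε
  simp only [Fintype.sum_option, Option.elim_none, Option.elim_some,
    hone none rfl] at hle
  have hcsum : c = tmul Γ (Lp.const ∞ μ (1 : ℤ)) w +
      ∑ j, tmul Γ (f j) (boundary n E (Finsupp.single (σ j) 1)) := by
    rw [← sub_eq_iff_eq_add', ← hb, map_sum]
    simp only [twistedBoundary_tmul]
  rw [← hcsum] at hle
  refine (iInf₂_le _ ?_).trans hle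
  have hbd : ∑ j, tmul Γ (f' (some j)) (boundary n E (Finsupp.single (σ j) 1)) =
      twistedBoundary Γ (LinfInt ν) n E
        (∑ j, tmul Γ (f' (some j)) (Finsupp.single (σ j) 1)) := by
    rw [map_sum]
    simp only [twistedBoundary_tmul]
  rw [hbd]
  refine ⟨add_mem (tmul_const_mem_twistedCycles hp ?_) (twistedBoundary_mem_twistedCycles _),
    z, _, hz, ⟨w, hwz, rfl⟩, ?_⟩
  · rw [hwz]
    exact hz.1
  · rw [add_sub_cancel_left]
    exact ⟨_, rfl⟩

end Comparison

end IFSV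

end

theorem theorem3p3
    -- an oriented closed connected `n`-manifold
    (n : ℕ) {M : Type*} [TopologicalSpace M] [T2Space M] [CompactSpace M] [ConnectedSpace M]
    [ChartedSpace (EuclideanSpace ℝ (Fin n)) M] (o : IFSV.Orientation n M)
    -- its universal covering, with the deck transformation action of its fundamental group
    {Γ : Type*} [Group Γ] {E : Type*} [TopologicalSpace E] [MulAction Γ E]
    [ContinuousConstSMul Γ E] (p : C(E, M)) (hp : IFSV.IsUniversalCovering Γ p)
    -- the free non-atomic standard `Γ`-space `α`
    {X : Type*} [MeasurableSpace X] [StandardBorelSpace X] (μ : MeasureTheory.Measure X)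
    [MeasureTheory.IsProbabilityMeasure μ] [MeasureTheory.NullSingletonClass μ] [MulAction Γ X]
    [MeasurableConstSMul Γ X] [MeasureTheory.SMulInvariantMeasure Γ X μ]
    (hα : IFSV.EssentiallyFree Γ μ)
    -- the free non-atomic standard `Γ`-space `β`
    {Y : Type*} [MeasurableSpace Y] [StandardBorelSpace Y] (ν : MeasureTheory.Measure Y)
    [MeasureTheory.IsProbabilityMeasure ν] [MeasureTheory.NullSingletonClass ν] [MulAction Γ Y]
    [MeasurableConstSMul Γ Y] [MeasureTheory.SMulInvariantMeasure Γ Y ν]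
    (hβ : IFSV.EssentiallyFree Γ ν)
    (hαβ : IFSV.WeaklyContained Γ μ ν) :
    IFSV.paramSimplicialVolume Γ p ν o ≤ IFSV.paramSimplicialVolume Γ p μ o := by
  refine le_iInf₂ fun c hc => ?_
  refine ENNReal.le_of_forall_pos_le_add fun ε hε _ => ?_
  exact hαβ.paramSimplicialVolume_le_l1Norm hp o hc (by exact_mod_cast hε.ne')
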